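/- Let $w:\mathbb{R}\to\mathbb{R}$ be a (Lebesgue measurable) $2\pi$-periodic weight that is positive almost everywhere, and let $L^2(\mathbb{T};w)$ be the space of (classes of) measurable functions $f:\mathbb{T}=[-\pi,\pi)\to\mathbb{C}$ with $\|f\|_{2,w}^2=\int_{-\pi}^{\pi}|f(t)|^2w(t)\,dt<\infty$. Let $\mathcal{T}=\{e_{n_k}\}_{k\ge 1}$, where $e_n(t)=(2\pi)^{-1/2}e^{int}$ and $\{n_k\}_{k\ge1}=\{0,-1,1,-2,2,\dots\}$. A Schauder basis $\{b_k\}_{k\ge1}$ of a Banach space $X$ with dual system $\{b_k^*\}$ is called quasi-greedy if $0<\inf_k\|b_k\|\le\sup_k\|b_k\|<\infty$ and, for every $x\in X$, the greedy approximants $\mathcal{G}_m(x)=\sum_{j=1}^m b^*_{\rho(j)}(x)\,b_{\rho(j)}$ satisfy $\|x-\mathcal{G}_m(x)\|\to0$ as $m\to\infty$. Here $\rho:\mathbb{N}\to\mathbb{N}$ is a greedy ordering for $x$: $\rho(\mathbb{N})\supseteq\{j:b_j^*(x)\ne0\}$, and for $j<k$ either $|b^*_{\rho(k)}(x)|<|b^*_{\rho(j)}(x)|$,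 or $|b^*_{\rho(k)}(x)|=|b^*_{\rho(j)}(x)|$ and $\rho(k)>\rho(j)$. A sequence $\{b_k\}$ is a Riesz basis of $X$ if its linear span is dense and there are constants $A,B>0$ such that $A\sum_k|a_k|^2\le\|\sum_k a_kb_k\|^2\le B\sum_k|a_k|^2$ for all finite complex sequences $(a_k)$. If $\mathcal{T}$ is contained in $L^2(\mathbb{T};w)$ and is a quasi-greedy basis for $L^2(\mathbb{T};w)$, then $\mathcal{T}$ is a Riesz basis for $L^2(\mathbb{T};w)$. Moreover, $\mathcal{T}$ is then an unconditional basis for $L^2(\mathbb{T};w)$ (the basis expansion of every element converges to it regardless of the ordering); that is, there are no conditional quasi-greedy trigonometric bases in weighted $L^2$. -/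

import Mathlib

open MeasureTheory Filter Topology

noncomputable section

/-- The enumeration `0, -1, 1, -2, 2, …` of the integers (indices start at `0`). -/
def trigIndex (k : ℕ) : ℤ :=
  if Even k then ((k / 2 : ℕ) : ℤ) else -(((k + 1) / 2 : ℕ) : ℤ)

/-- The `k`-th function `t ↦ (2π)^{-1/2} e^{i n_k t}` of the trigonometric system in its natural
ordering, `n_k = trigIndex k`. -/
def trigFun (k : ℕ) (t : ℝ) : ℂ :=
  ((Real.sqrt (2 * Real.pi))⁻¹ : ℝ) * Complex.exp (Complex.I * (trigIndex k : ℂ) * (t : ℂ))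

/-- The measure `w(t) dt` on `[-π, π)`. -/
def weightMeasure (w : ℝ → ℝ) : Measure ℝ :=
  (volume.restrict (Set.Ico (-Real.pi) Real.pi)).withDensity fun t => ENNReal.ofReal (w t)

/-- The weighted space `L²(𝕋; w)`. -/
abbrev WeightedL2 (w : ℝ → ℝ) : Type := Lp ℂ 2 (weightMeasure w)

section Bases

variable {X : Type*} [NormedAddCommGroup X] [NormedSpace ℂ X]

/-- `ρ` is a greedy ordering of the coefficient sequence `c`: its range contains the support of `c`,
and it runs through the coefficients in order of decreasing modulus, ties being broken by
the smaller index. -/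
def IsGreedyOrdering (c : ℕ → ℂ) (ρ : ℕ → ℕ) : Prop :=
  {j | c j ≠ 0} ⊆ Set.range ρ ∧
    ∀ j k : ℕ, j < k →
      ‖c (ρ k)‖ < ‖c (ρ j)‖ ∨ (‖c (ρ k)‖ = ‖c (ρ j)‖ ∧ ρ j < ρ k)

/-- The greedy `m`-term approximant of `x` along the ordering `ρ`. -/
def greedyApprox (S : SchauderBasis ℂ X) (x : X) (ρ : ℕ → ℕ) (m : ℕ) : X :=
  ∑ j ∈ Finset.range m, S.coord (ρ j) x • S (ρ j)

/-- `b` is a quasi-greedy basis: a Schauder basis, bounded above and away from zero, whose greedy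
approximants converge in norm to `x` for every `x`. -/
def IsQuasiGreedyBasis (b : ℕ → X) : Prop :=
  ∃ S : SchauderBasis ℂ X, (⇑S = b) ∧
    (∃ c C : ℝ, 0 < c ∧ ∀ k, c ≤ ‖b k‖ ∧ ‖b k‖ ≤ C) ∧
    ∀ (x : X) (ρ : ℕ → ℕ), IsGreedyOrdering (fun k => S.coord k x) ρ →
      Tendsto (fun m => ‖x - greedyApprox S x ρ m‖) atTop (𝓝 0)

/-- `b` is an unconditional basis: the basis expansions converge irrespective of the order. -/
def IsUnconditionalBasis (b : ℕ → X) : Prop :=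
  ∃ S : UnconditionalSchauderBasis ℕ ℂ X, ⇑S = b

/-- `b` is a Riesz basis: its span is dense and `‖∑ a_k b_k‖²` is comparable with `∑ |a_k|²`, uniformly
over finite sequences. -/
def IsRieszBasis (b : ℕ → X) : Prop :=
  (Submodule.span ℂ (Set.range b)).topologicalClosure = ⊤ ∧
    ∃ A B : ℝ, 0 < A ∧ 0 < B ∧ ∀ (s : Finset ℕ) (a : ℕ → ℂ),
      A * ∑ k ∈ s, ‖a k‖ ^ 2 ≤ ‖∑ k ∈ s, a k • b k‖ ^ 2 ∧
        ‖∑ k ∈ s, a k • b k‖ ^ 2 ≤ B * ∑ k ∈ s, ‖a k‖ ^ 2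

end Bases

/-- The trigonometric system, as a sequence in `L²(𝕋; w)`, given that it lies in that space. -/
def trigSystem {w : ℝ → ℝ} (h : ∀ k, MemLp (trigFun k) 2 (weightMeasure w)) (k : ℕ) :
    WeightedL2 w :=
  (h k).toLp (trigFun k)

/-- The trigonometric system lies in `L²(𝕋; w)` and is a quasi-greedy basis of it. -/
def TrigIsQuasiGreedy (w : ℝ → ℝ) : Prop :=
  ∃ h : ∀ k, MemLp (trigFun k) 2 (weightMeasure w), IsQuasiGreedyBasis (trigSystem h)

/-- The trigonometric system lies in `L²(𝕋; w)` and is a Riesz basis of it. -/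
def TrigIsRiesz (w : ℝ → ℝ) : Prop :=
  ∃ h : ∀ k, MemLp (trigFun k) 2 (weightMeasure w), IsRieszBasis (trigSystem h)

/-- The trigonometric system lies in `L²(𝕋; w)` and is an unconditional basis of it. -/
def TrigIsUnconditional (w : ℝ → ℝ) : Prop :=
  ∃ h : ∀ k, MemLp (trigFun k) 2 (weightMeasure w), IsUnconditionalBasis (trigSystem h)

end

/-!
A quasi-greedy trigonometric basis of `L²(𝕋; w)` is a Riesz basis, hence unconditional. Write `b_k`
for the basis vectors.

* The greedy projections of a quasi-greedy basis are uniformly bounded on finitely supported vectors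
  (`exists_norm_sum_greedySet_le`). Perturbing unimodular coefficients slightly turns any subset of
  the support into a greedy set, so `‖∑_B ε_k b_k‖ ≤ K ‖∑_A ε_k b_k‖` for `B ⊆ A` and unimodular `ε`
  (`norm_sum_unimodular_subset_le`).
* Consequently, changing signs alters the norm of a unimodular sum by at most a constant factor. In a
  Hilbert space the average of `‖∑_A ± ε_k b_k‖²` over the signs is `∑_A ‖b_k‖²`, so
  `‖∑_A ε_k b_k‖²` is comparable with `∑_A ‖b_k‖²` (`norm_sum_unimodular_sq_bounds`).
* The Gram matrix of the trigonometric system is a Toeplitz matrix, with constant diagonal in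
  particular. For the frequencies `k = 0, …, N - 1` and `ε_k = e^{-ikθ}` the previous comparison says
  that the mean of `w` against a Fejér kernel at `θ` is bounded above and below. Instead of deducing
  bounds for `w` itself, the comparison is integrated against `|p(θ)|²` for a trigonometric polynomial
  `p`. Up to a factor tending to `1` in each matrix entry, the result is `N` times the norm of `p` in
  `L²(𝕋; w)` squared, which yields the Riesz inequalities directly (`riesz_bounds_of_stationary`).
* The Riesz inequalities make the expansion of every vector unconditionally summable
  (`IsRieszBasis.isUnconditionalBasis`).
-/

/-! ### Greedy orderings -/

/-- A null sequence with infinite support has a greedy ordering: ordering the support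
lexicographically by decreasing modulus and increasing index leaves only finitely many predecessors
of each element, so the support is order isomorphic to `ℕ`. -/
theorem exists_isGreedyOrdering {c : ℕ → ℂ} (hc : Tendsto c atTop (𝓝 0))
    (hinf : {j | c j ≠ 0}.Infinite) : ∃ ρ : ℕ → ℕ, IsGreedyOrdering c ρ := by
  classical
  let key : ℕ → ℝ ×ₗ ℕ := fun k => toLex (-‖c k‖, k)
  have key_inj : Function.Injective key := fun a b h => by
    have := congrArg (fun p => (ofLex p).2) h
    simpa [key] using this
  let T : Set (ℝ ×ₗ ℕ) := key '' {j | c j ≠ 0}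
  have hTinf : T.Infinite := hinf.image key_inj.injOn
  have hfin : ∀ t : T, (Set.Iic t).Finite := by
    rintro ⟨_, k, hk, rfl⟩
    have hk : c k ≠ 0 := hk
    have hsmall : ∀ᶠ j in atTop, ‖c j‖ < ‖c k‖ :=
      (tendsto_norm_zero.comp hc).eventually_lt_const (norm_pos_iff.2 hk)
    obtain ⟨N, hN⟩ := eventually_atTop.1 hsmall
    refine Set.Finite.of_finite_image (f := Subtype.val)
      (((Set.finite_Iio N).image key).subset ?_) Subtype.val_injective.injOn
    rintro _ ⟨⟨_, j, hj, rfl⟩, hle, rfl⟩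
    refine ⟨j, ?_, rfl⟩
    by_contra hjN
    have h1 := hN j (not_lt.1 hjN)
    have h2 : key j ≤ key k := hle
    rw [Prod.Lex.le_iff] at h2
    simp only [key, ofLex_toLex] at h2
    rcases h2 with h2 | h2
    · linarith
    · linarith [h2.1]
  have : Infinite T := hTinf.to_subtype
  have : NoMaxOrder T := by
    refine ⟨fun t => ?_⟩
    by_contra! h
    exact Set.infinite_univ (α := T) ((hfin t).subset fun s _ => h s)
  let _ : OrderBot T := by
    have : ∃ m : T, ∀ t, m ≤ t := by
      obtain ⟨t⟩ : Nonempty T := inferInstance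
      obtain ⟨m, hm, hmin⟩ := (hfin t).exists_minimal ⟨t, le_refl t⟩
      refine ⟨m, fun s => ?_⟩
      rcases le_total s t with h | h
      · rcases le_total m s with h' | h'
        · exact h'
        · exact hmin h h'
      · exact le_trans hm h
    exact { bot := this.choose, bot_le := this.choose_spec }
  let _ : LocallyFiniteOrder T :=
    LocallyFiniteOrder.ofFiniteIcc fun a b => (hfin b).subset Set.Icc_subset_Iic_self
  let _ : SuccOrder T := LinearLocallyFiniteOrder.succOrder T
  let _ : PredOrder T := LinearLocallyFiniteOrder.predOrder T
  let e : T ≃o ℕ := orderIsoNatOfLinearSuccPredArch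
  have hspec : ∀ n, key (ofLex (e.symm n).1).2 = (e.symm n).1 := by
    intro n
    obtain ⟨k, -, hk⟩ := (e.symm n).2
    rw [← hk]
    rfl
  refine ⟨fun n => (ofLex (e.symm n).1).2, ?_, ?_⟩
  · intro j hj
    refine ⟨e ⟨key j, j, hj, rfl⟩, ?_⟩
    simp [key]
  · intro j k hjk
    have h : (e.symm j).1 < (e.symm k).1 := e.symm.strictMono hjk
    rw [← hspec j, ← hspec k, Prod.Lex.lt_iff] at h
    simp only [key, ofLex_toLex, neg_lt_neg_iff, neg_inj] at h
    rcases h with h | h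
    · exact Or.inl h
    · exact Or.inr ⟨h.1.symm, h.2⟩

theorem IsGreedyOrdering.injective {c : ℕ → ℂ} {ρ : ℕ → ℕ} (h : IsGreedyOrdering c ρ) :
    Function.Injective ρ := by
  have key : ∀ j k, j < k → ρ j ≠ ρ k := fun j k hjk heq => by
    rcases h.2 j k hjk with h' | h'
    · exact absurd h' (by simp [heq])
    · exact absurd h'.2 (by simp [heq])
  intro j k heq
  by_contra hne
  rcases lt_or_gt_of_ne hne with hlt | hlt
  · exact key j k hlt heq
  · exact key k j hlt heq.symm

/-- A finite set carrying coefficients that are strictly larger than all the others is exhausted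
first by every greedy ordering. -/
theorem IsGreedyOrdering.image_range_card {c : ℕ → ℂ} {ρ : ℕ → ℕ} (h : IsGreedyOrdering c ρ)
    {A : Finset ℕ} (hA : ∀ k ∈ A, ∀ j ∉ A, ‖c j‖ < ‖c k‖) (hA0 : ∀ k ∈ A, c k ≠ 0) :
    (Finset.range A.card).image ρ = A := by
  classical
  have hinj := h.injective
  have hsub : ∀ k ∈ A, ∃ n, ρ n = k := fun k hk => h.1 (hA0 k hk)
  have himg : (A.preimage ρ hinj.injOn).image ρ = A := by
    rw [Finset.image_preimage]
    exact Finset.filter_true_of_mem fun k hk => hsub k hk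
  have hlower : ∀ i ∈ A.preimage ρ hinj.injOn, ∀ j < i, j ∈ A.preimage ρ hinj.injOn := by
    intro i hi j hji
    rw [Finset.mem_preimage] at hi ⊢
    by_contra hj
    have h1 := hA _ hi _ hj
    rcases h.2 j i hji with h2 | h2
    · linarith
    · linarith [h2.1]
  have hcard : (A.preimage ρ hinj.injOn).card = A.card := by
    rw [← Finset.card_image_of_injective _ hinj, himg]
  have hrange : Finset.range A.card = A.preimage ρ hinj.injOn := by
    symm
    apply Finset.eq_of_subset_of_card_le
    · intro i hi
      rw [Finset.mem_range, ← hcard]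
      have : Finset.range (i + 1) ⊆ A.preimage ρ hinj.injOn := by
        intro j hj
        rcases Nat.lt_succ_iff_lt_or_eq.1 (Finset.mem_range.1 hj) with h' | h'
        · exact hlower i hi j h'
        · exact h' ▸ hi
      simpa using Finset.card_le_card this
    · simp [hcard]
  rw [hrange, himg]

theorem greedyApprox_card {X : Type*} [NormedAddCommGroup X] [NormedSpace ℂ X]
    {S : SchauderBasis ℂ X} {x : X} {ρ : ℕ → ℕ}
    (h : IsGreedyOrdering (fun k => S.coord k x) ρ) {A : Finset ℕ}
    (hA : ∀ k ∈ A, ∀ j ∉ A, ‖S.coord j x‖ < ‖S.coord k x‖) (hA0 : ∀ k ∈ A, S.coord k x ≠ 0) :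
    greedyApprox S x ρ A.card = ∑ k ∈ A, S.coord k x • S k := by
  conv_rhs => rw [← h.image_range_card hA hA0]
  rw [Finset.sum_image fun a _ b _ hab => h.injective hab]
  rfl

/-! ### Uniform boundedness of greedy projections -/

section GreedyProjections

variable {X : Type*} [NormedAddCommGroup X] [NormedSpace ℂ X]

theorem SchauderBasis.coord_sum_smul (S : SchauderBasis ℂ X) (A : Finset ℕ) (a : ℕ → ℂ) (j : ℕ) :
    S.coord j (∑ k ∈ A, a k • S k) = if j ∈ A then a j else 0 := by
  simp [S.ortho, Pi.single_apply]

theorem SchauderBasis.tendsto_coord (S : SchauderBasis ℂ X) {c : ℝ} (hc : 0 < c)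
    (hS : ∀ k, c ≤ ‖S k‖) (x : X) : Tendsto (fun k => S.coord k x) atTop (𝓝 0) := by
  have h1 := S.tendsto_proj x
  have h2 := ((h1.comp (tendsto_add_atTop_nat 1)).sub h1).norm
  simp only [sub_self, norm_zero] at h2
  have h3 := h2.const_mul c⁻¹
  rw [mul_zero] at h3
  refine squeeze_zero_norm (fun k => ?_) h3
  have h4 : (SchauderBasis.proj S (k + 1)) x - (SchauderBasis.proj S k) x = S.coord k x • S k := by
    rw [SchauderBasis.proj_apply, SchauderBasis.proj_apply, Finset.sum_range_succ,
      add_sub_cancel_left]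
  simp only [Function.comp_apply]
  rw [h4, norm_smul, ← div_eq_inv_mul, le_div_iff₀ hc]
  exact mul_le_mul_of_nonneg_left (hS k) (norm_nonneg _)

/-- The coordinate functionals are uniformly bounded; the bound is taken at least `1` for
convenience. -/
theorem SchauderBasis.exists_norm_coord_le [CompleteSpace X] (S : SchauderBasis ℂ X) {c : ℝ}
    (hc : 0 < c) (hS : ∀ k, c ≤ ‖S k‖) : ∃ C : ℝ, 1 ≤ C ∧ ∀ k x, ‖S.coord k x‖ ≤ C * ‖x‖ := by
  obtain ⟨C, hC⟩ := banach_steinhaus (g := S.coord) fun x => by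
    obtain ⟨M, hM⟩ := isBounded_iff_forall_norm_le.mp
      (Metric.isBounded_range_of_tendsto _ (S.tendsto_coord hc hS x))
    exact ⟨M, Set.forall_mem_range.mp hM⟩
  exact ⟨max C 1, le_max_right _ _, fun k x =>
    (S.coord k).le_of_opNorm_le ((hC k).trans (le_max_left _ _)) x⟩

/-- `B` is a greedy set of the finitely supported vector with support `A` and coefficients `a`:
every coefficient on `B` is strictly larger in modulus than every coefficient on `A \ B`. -/
structure IsGreedySet (a : ℕ → ℂ) (A B : Finset ℕ) : Prop where
  subset : B ⊆ A
  ne_zero : ∀ k ∈ A, a k ≠ 0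
  lt : ∀ k ∈ B, ∀ j ∈ A, j ∉ B → ‖a j‖ < ‖a k‖

/-- If the greedy projections of finitely supported vectors are not uniformly bounded, then the
vectors witnessing this can be taken with support far out and arbitrarily small norm. -/
theorem exists_greedy_bump {S : SchauderBasis ℂ X} {C M : ℝ} (hC1 : 1 ≤ C)
    (hC : ∀ k x, ‖S.coord k x‖ ≤ C * ‖x‖) (hM : ∀ k, ‖S k‖ ≤ M)
    (hbad : ∀ K : ℝ, ∃ (a : ℕ → ℂ) (A B : Finset ℕ), IsGreedySet a A B ∧
      K * ‖∑ k ∈ A, a k • S k‖ < ‖∑ k ∈ B, a k • S k‖) (N : ℕ) {δ : ℝ} (hδ : 0 < δ) :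
    ∃ (a : ℕ → ℂ) (A B : Finset ℕ), IsGreedySet a A B ∧ (∀ k ∈ A, N ≤ k) ∧
      (∀ k ∈ A, ‖a k‖ ≤ δ) ∧ ‖∑ k ∈ A, a k • S k‖ ≤ δ ∧ ‖∑ k ∈ B, a k • S k‖ = 1 := by
  classical
  have hM0 : 0 ≤ M := (norm_nonneg _).trans (hM 0)
  set K : ℝ := C / δ with hK
  have hKpos : 0 < K := div_pos (by linarith) hδ
  obtain ⟨a, A, B, hAB, hlt⟩ := hbad (K * (1 + N * (C * M)) + N * (C * M))
  set y := ∑ k ∈ A, a k • S k with hy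
  -- Discard the first `N` coordinates; this costs at most `N * (C * M) * ‖y‖`.
  have hhead : ∀ D : Finset ℕ, D ⊆ A →
      ‖∑ k ∈ D with ¬ N ≤ k, a k • S k‖ ≤ N * (C * M) * ‖y‖ := by
    intro D hD
    have h1 : ∀ k ∈ D.filter (fun k => ¬ N ≤ k), ‖a k • S k‖ ≤ C * M * ‖y‖ := by
      intro k hk
      have hkA : k ∈ A := hD (Finset.mem_filter.1 hk).1
      have h2 : a k = S.coord k y := by rw [hy, S.coord_sum_smul, if_pos hkA]
      rw [norm_smul, h2]
      calc ‖S.coord k y‖ * ‖S k‖ ≤ (C * ‖y‖) * M :=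
            mul_le_mul (hC k y) (hM k) (norm_nonneg _) (by positivity)
        _ = C * M * ‖y‖ := by ring
    refine (norm_sum_le_of_le _ h1).trans ?_
    rw [Finset.sum_const, nsmul_eq_mul, ← mul_assoc]
    have h3 : (D.filter (fun k => ¬ N ≤ k)).card ≤ N := by
      refine (Finset.card_le_card (t := Finset.range N) fun k hk => ?_).trans (by simp)
      simpa using (Finset.mem_filter.1 hk).2
    have h4 : ((D.filter (fun k => ¬ N ≤ k)).card : ℝ) ≤ N := by exact_mod_cast h3
    have : 0 ≤ C * M := by positivity
    gcongr
  set A' := A.filter (N ≤ ·) with hA'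
  set B' := B.filter (N ≤ ·) with hB'
  have hsplitA := Finset.sum_filter_add_sum_filter_not A (N ≤ ·) (fun k => a k • S k)
  have hsplitB := Finset.sum_filter_add_sum_filter_not B (N ≤ ·) (fun k => a k • S k)
  have hyA : ‖∑ k ∈ A', a k • S k‖ ≤ (1 + N * (C * M)) * ‖y‖ := by
    have h1 := hhead A subset_rfl
    have h2 : ∑ k ∈ A', a k • S k = y - ∑ k ∈ A with ¬ N ≤ k, a k • S k := by
      rw [hy, ← hsplitA, add_sub_cancel_right]
    rw [h2]
    linarith [norm_sub_le y (∑ k ∈ A with ¬ N ≤ k, a k • S k)]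
  have hyB : K * ‖∑ k ∈ A', a k • S k‖ < ‖∑ k ∈ B', a k • S k‖ := by
    have h1 := hhead B hAB.subset
    have h2 : ‖∑ k ∈ B, a k • S k‖ ≤
        ‖∑ k ∈ B', a k • S k‖ + ‖∑ k ∈ B with ¬ N ≤ k, a k • S k‖ := by
      rw [← hsplitB]
      exact norm_add_le _ _
    have h3 := mul_le_mul_of_nonneg_left hyA hKpos.le
    nlinarith
  set r := ‖∑ k ∈ B', a k • S k‖ with hr
  have hrpos : 0 < r := lt_of_le_of_lt (by positivity) hyB
  have hscale : ∀ D : Finset ℕ,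
      ∑ k ∈ D, ((r⁻¹ : ℝ) * a k : ℂ) • S k = ((r⁻¹ : ℝ) : ℂ) • ∑ k ∈ D, a k • S k := by
    intro D
    rw [Finset.smul_sum]
    exact Finset.sum_congr rfl fun k _ => mul_smul _ _ _
  have hnorm : ‖((r⁻¹ : ℝ) : ℂ)‖ = r⁻¹ := by
    rw [Complex.norm_real, Real.norm_of_nonneg (by positivity)]
  have hsmall : C * ‖∑ k ∈ A', ((r⁻¹ : ℝ) * a k : ℂ) • S k‖ ≤ δ := by
    rw [hscale, norm_smul, hnorm]
    have h1 : C * ‖∑ k ∈ A', a k • S k‖ < r * δ := by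
      rw [hK, div_mul_eq_mul_div, div_lt_iff₀ hδ] at hyB
      exact hyB
    calc C * (r⁻¹ * ‖∑ k ∈ A', a k • S k‖) = (C * ‖∑ k ∈ A', a k • S k‖) / r := by
          rw [div_eq_inv_mul]; ring
      _ ≤ δ := by rw [div_le_iff₀ hrpos]; linarith
  refine ⟨fun k => (r⁻¹ : ℝ) * a k, A', B', ⟨?_, ?_, ?_⟩, ?_, ?_, ?_, ?_⟩
  · exact Finset.filter_subset_filter _ hAB.subset
  · intro k hk
    refine mul_ne_zero ?_ (hAB.ne_zero k (Finset.mem_filter.1 hk).1)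
    exact_mod_cast (inv_pos.2 hrpos).ne'
  · intro k hk j hj hjB
    rw [norm_mul, norm_mul, hnorm]
    refine mul_lt_mul_of_pos_left ?_ (inv_pos.2 hrpos)
    rw [hA', Finset.mem_filter] at hj
    refine hAB.lt k (Finset.mem_filter.1 hk).1 j hj.1 fun h => hjB ?_
    exact Finset.mem_filter.2 ⟨h, hj.2⟩
  · intro k hk
    exact (Finset.mem_filter.1 hk).2
  · intro k hk
    have h1 := hC k (∑ k ∈ A', ((r⁻¹ : ℝ) * a k : ℂ) • S k)
    rw [S.coord_sum_smul A' (fun k => (r⁻¹ : ℝ) * a k), if_pos hk] at h1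
    exact h1.trans hsmall
  · refine le_trans ?_ hsmall
    exact le_mul_of_one_le_left (norm_nonneg _) hC1
  · rw [hscale, norm_smul, hnorm, ← hr, inv_mul_cancel₀ hrpos.ne']

/-- Greedy projections converging at every vector are uniformly bounded on finitely supported
vectors. The greedy projections are not linear, so the uniform boundedness principle is replaced by
a gliding hump: otherwise, vectors with successive supports, decreasing coefficients, small norms
and greedy projections of norm `1` add up to a vector whose greedy approximants are not Cauchy. -/
theorem exists_norm_sum_greedySet_le [CompleteSpace X] (S : SchauderBasis ℂ X) {c M : ℝ}
    (hc : 0 < c) (hS : ∀ k, c ≤ ‖S k‖) (hM : ∀ k, ‖S k‖ ≤ M)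
    (hG : ∀ (x : X) (ρ : ℕ → ℕ), IsGreedyOrdering (fun k => S.coord k x) ρ →
      Tendsto (fun m => ‖x - greedyApprox S x ρ m‖) atTop (𝓝 0)) :
    ∃ K : ℝ, ∀ (a : ℕ → ℂ) (A B : Finset ℕ), IsGreedySet a A B →
      ‖∑ k ∈ B, a k • S k‖ ≤ K * ‖∑ k ∈ A, a k • S k‖ := by
  classical
  obtain ⟨C, hC1, hC⟩ := S.exists_norm_coord_le hc hS
  by_contra! hbad
  -- The state `s = (N, δ)` records that the next block lives beyond `N`, at size at most `δ`.
  have step : ∀ s : ℕ × {δ : ℝ // 0 < δ}, ∃ (a : ℕ → ℂ) (A B : Finset ℕ)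
      (s' : ℕ × {δ : ℝ // 0 < δ}), IsGreedySet a A B ∧ (∀ k ∈ A, s.1 ≤ k ∧ k < s'.1) ∧
      (∀ k ∈ A, (s'.2 : ℝ) < ‖a k‖ ∧ ‖a k‖ ≤ s.2) ∧ ‖∑ k ∈ A, a k • S k‖ ≤ s.2 ∧
      ‖∑ k ∈ B, a k • S k‖ = 1 ∧ s.1 ≤ s'.1 ∧ (s'.2 : ℝ) ≤ s.2 / 2 := by
    rintro ⟨N, δ, hδ⟩
    obtain ⟨a, A, B, hAB, hN, hle, hy, hB⟩ := exists_greedy_bump hC1 hC hM hbad N hδ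
    obtain ⟨η, hη0, hη⟩ : ∃ η : ℝ, 0 < η ∧ ∀ k ∈ A, η < ‖a k‖ := by
      have hne : A.Nonempty := by
        rw [Finset.nonempty_iff_ne_empty]
        rintro rfl
        rw [Finset.subset_empty.1 hAB.subset] at hB
        simp at hB
      obtain ⟨k₀, hk₀, hmin⟩ := A.exists_min_image (fun k => ‖a k‖) hne
      have h0 : 0 < ‖a k₀‖ := norm_pos_iff.2 (hAB.ne_zero k₀ hk₀)
      exact ⟨‖a k₀‖ / 2, half_pos h0, fun k hk => lt_of_lt_of_le (half_lt_self h0) (hmin k hk)⟩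
    refine ⟨a, A, B, (max N (A.sup id + 1), ⟨min (δ / 2) η, lt_min (half_pos hδ) hη0⟩), hAB,
      fun k hk => ⟨hN k hk, ?_⟩, fun k hk => ⟨(min_le_right _ _).trans_lt (hη k hk), hle k hk⟩,
      hy, hB, le_max_left _ _, min_le_left _ _⟩
    exact lt_of_lt_of_le (Nat.lt_succ_of_le (Finset.le_sup (f := id) hk)) (le_max_right _ _)
  choose a' A' B' nxt hnxt using step
  set st : ℕ → ℕ × {δ : ℝ // 0 < δ} := fun n => nxt^[n] (0, ⟨1, one_pos⟩) with hst
  have hst_succ : ∀ n, st (n + 1) = nxt (st n) := fun n => Function.iterate_succ_apply' _ _ _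
  set a := fun n => a' (st n) with ha
  set A := fun n => A' (st n) with hA
  set B := fun n => B' (st n) with hB
  set N := fun n => (st n).1 with hN
  set δ : ℕ → ℝ := fun n => (st n).2 with hδ
  have hδ0 : ∀ n, 0 < δ n := fun n => (st n).2.2
  have hgs : ∀ n, IsGreedySet (a n) (A n) (B n) := fun n => (hnxt (st n)).1
  have hAN : ∀ n, ∀ k ∈ A n, N n ≤ k ∧ k < N (n + 1) := fun n => by
    simpa only [hN, hst_succ] using (hnxt (st n)).2.1
  have hAδ : ∀ n, ∀ k ∈ A n, δ (n + 1) < ‖a n k‖ ∧ ‖a n k‖ ≤ δ n := fun n => by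
    simpa only [hδ, hst_succ] using (hnxt (st n)).2.2.1
  have hy : ∀ n, ‖∑ k ∈ A n, a n k • S k‖ ≤ δ n := fun n => (hnxt (st n)).2.2.2.1
  have hB1 : ∀ n, ‖∑ k ∈ B n, a n k • S k‖ = 1 := fun n => (hnxt (st n)).2.2.2.2.1
  have hNmono : Monotone N := monotone_nat_of_le_succ fun n => by
    simpa only [hN, hst_succ] using (hnxt (st n)).2.2.2.2.2.1
  have hδhalf : ∀ n, δ (n + 1) ≤ δ n / 2 := fun n => by
    simpa only [hδ, hst_succ] using (hnxt (st n)).2.2.2.2.2.2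
  have hδanti : Antitone δ := antitone_nat_of_succ_le fun n => by
    linarith [hδhalf n, hδ0 n]
  have hδgeom : ∀ n, δ n ≤ (1 / 2) ^ n := by
    intro n
    induction n with
    | zero => simp [hδ, hst]
    | succ n ih => rw [pow_succ]; linarith [hδhalf n]
  have hdisj : ∀ m n k, k ∈ A m → k ∈ A n → m = n := by
    have key : ∀ m n k, m < n → k ∈ A m → k ∉ A n := fun m n k hmn hm hn =>
      absurd ((hAN n k hn).1) (not_le.2 ((hAN m k hm).2.trans_le (hNmono hmn)))
    intro m n k hm hn
    by_contra hne
    rcases lt_or_gt_of_ne hne with h | h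
    · exact key m n k h hm hn
    · exact key n m k h hn hm
  have hsum : Summable fun n => ∑ k ∈ A n, a n k • S k :=
    Summable.of_norm_bounded summable_geometric_two fun n => (hy n).trans (hδgeom n)
  set x := ∑' n, ∑ k ∈ A n, a n k • S k with hx
  have hcoord : ∀ j, HasSum (fun n => if j ∈ A n then a n j else 0) (S.coord j x) := by
    intro j
    have h1 := (S.coord j).hasSum hsum.hasSum
    simpa only [S.coord_sum_smul] using h1
  have hcoord_mem : ∀ n, ∀ j ∈ A n, S.coord j x = a n j := by
    intro n j hj
    refine (hcoord j).unique ?_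
    have h1 := hasSum_single (f := fun n => if j ∈ A n then a n j else 0) n fun m hm => by
      rw [if_neg fun h => hm (hdisj m n j h hj)]
    simpa only [if_pos hj] using h1
  have hcoord_not : ∀ j, (∀ n, j ∉ A n) → S.coord j x = 0 := by
    intro j hj
    refine (hcoord j).unique ?_
    simpa only [if_neg (hj _)] using (hasSum_zero : HasSum (fun _ : ℕ => (0 : ℂ)) 0)
  have hBne : ∀ n, (B n).Nonempty := by
    intro n
    rw [Finset.nonempty_iff_ne_empty]
    intro h
    have h1 := hB1 n
    rw [h] at h1
    simp at h1
  -- The greedy sets of `x`: the first `n` blocks, without and with the greedy part of the next one.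
  set U : ℕ → Finset ℕ := fun n => (Finset.range n).biUnion A with hU
  set V : ℕ → Finset ℕ := fun n => U n ∪ B n with hV
  have hUmem : ∀ n k, k ∈ U n ↔ ∃ m < n, k ∈ A m := by
    intro n k
    simp [hU]
  have hBU : ∀ n, Disjoint (U n) (B n) := by
    intro n
    rw [Finset.disjoint_left]
    intro k hk hkB
    obtain ⟨m, hm, hkm⟩ := (hUmem n k).1 hk
    exact hm.ne (hdisj m n k hkm ((hgs n).subset hkB))
  have hUbig : ∀ n, ∀ k ∈ U n, δ n < ‖S.coord k x‖ := by
    intro n k hk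
    obtain ⟨m, hm, hkm⟩ := (hUmem n k).1 hk
    rw [hcoord_mem m k hkm]
    exact (hδanti hm).trans_lt (hAδ m k hkm).1
  have hUsmall : ∀ n, ∀ j ∉ U n, ‖S.coord j x‖ ≤ δ n := by
    intro n j hj
    by_cases h : ∃ m, j ∈ A m
    · obtain ⟨m, hm⟩ := h
      rw [hcoord_mem m j hm]
      have hnm : n ≤ m := not_lt.1 fun h => hj ((hUmem n j).2 ⟨m, h, hm⟩)
      exact (hAδ m j hm).2.trans (hδanti hnm)
    · rw [hcoord_not j (not_exists.1 h), norm_zero]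
      exact (hδ0 n).le
  have hBcoord : ∀ n, ∀ k ∈ B n, S.coord k x = a n k := fun n k hk =>
    hcoord_mem n k ((hgs n).subset hk)
  have hUdom : ∀ n, ∀ k ∈ U n, ∀ j ∉ U n, ‖S.coord j x‖ < ‖S.coord k x‖ := fun n k hk j hj =>
    (hUsmall n j hj).trans_lt (hUbig n k hk)
  have hVdom : ∀ n, ∀ k ∈ V n, ∀ j ∉ V n, ‖S.coord j x‖ < ‖S.coord k x‖ := by
    intro n k hk j hj
    simp only [hV, Finset.mem_union, not_or] at hk hj
    rcases hk with hk | hk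
    · exact hUdom n k hk j hj.1
    · by_cases hjA : j ∈ A n
      · rw [hBcoord n k hk, hcoord_mem n j hjA]
        exact (hgs n).lt k hk j hjA hj.2
      · have hjU : j ∉ U (n + 1) := by
          intro h
          obtain ⟨m, hm, hjm⟩ := (hUmem _ j).1 h
          rcases Nat.lt_succ_iff_lt_or_eq.1 hm with h' | h'
          · exact hj.1 ((hUmem n j).2 ⟨m, h', hjm⟩)
          · exact hjA (h' ▸ hjm)
        have hkU : k ∈ U (n + 1) :=
          (hUmem _ k).2 ⟨n, n.lt_succ_self, (hgs n).subset hk⟩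
        exact hUdom (n + 1) k hkU j hjU
  have hU0 : ∀ n, ∀ k ∈ U n, S.coord k x ≠ 0 := fun n k hk =>
    norm_pos_iff.1 ((hδ0 n).trans (hUbig n k hk))
  have hV0 : ∀ n, ∀ k ∈ V n, S.coord k x ≠ 0 := by
    intro n k hk
    rcases Finset.mem_union.1 hk with hk | hk
    · exact hU0 n k hk
    · rw [hBcoord n k hk]
      exact (hgs n).ne_zero k ((hgs n).subset hk)
  have hUcard : ∀ n, n ≤ (U n).card := by
    intro n
    induction n with
    | zero => simp
    | succ n ih =>
      have hsub : U n ∪ B n ⊆ U (n + 1) := by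
        intro k hk
        rcases Finset.mem_union.1 hk with hk | hk
        · obtain ⟨m, hm, hkm⟩ := (hUmem n k).1 hk
          exact (hUmem _ k).2 ⟨m, hm.trans n.lt_succ_self, hkm⟩
        · exact (hUmem _ k).2 ⟨n, n.lt_succ_self, (hgs n).subset hk⟩
      have h1 := Finset.card_le_card hsub
      rw [Finset.card_union_of_disjoint (hBU n)] at h1
      have h2 := (hBne n).card_pos
      omega
  have hinf : {j | S.coord j x ≠ 0}.Infinite := by
    refine Set.infinite_of_forall_exists_gt fun n => ?_
    by_contra! h
    have h1 : U (n + 2) ⊆ Finset.range (n + 1) := fun k hk =>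
      Finset.mem_range.2 (Nat.lt_succ_of_le (h k (hU0 _ k hk)))
    have h2 := Finset.card_le_card h1
    have h3 := hUcard (n + 2)
    rw [Finset.card_range] at h2
    omega
  obtain ⟨ρ, hρ⟩ := exists_isGreedyOrdering (S.tendsto_coord hc hS x) hinf
  have hlim := hG x ρ hρ
  have hUtop : Tendsto (fun n => (U n).card) atTop atTop := tendsto_atTop_mono hUcard tendsto_id
  have hVtop : Tendsto (fun n => (V n).card) atTop atTop :=
    tendsto_atTop_mono (fun n => Finset.card_le_card Finset.subset_union_left) hUtop
  have hlim2 := (hlim.comp hUtop).add (hlim.comp hVtop)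
  rw [add_zero] at hlim2
  refine absurd (ge_of_tendsto' hlim2 (b := 1) fun n => ?_) (by norm_num)
  simp only [Function.comp_apply]
  rw [greedyApprox_card hρ (hUdom n) (hU0 n), greedyApprox_card hρ (hVdom n) (hV0 n),
    ← hB1 n, Finset.sum_union (hBU n)]
  have h1 : ∑ k ∈ B n, a n k • S k = ∑ k ∈ B n, S.coord k x • S k :=
    Finset.sum_congr rfl fun k hk => by rw [hBcoord n k hk]
  rw [h1]
  set u := ∑ k ∈ U n, S.coord k x • S k
  set v := ∑ k ∈ B n, S.coord k x • S k
  calc ‖v‖ = ‖(x - u) - (x - (u + v))‖ := by congr 1; abel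
    _ ≤ _ := norm_sub_le _ _

/-- Quasi-greedy bases are unconditional for constant coefficients. -/
theorem norm_sum_unimodular_subset_le {b : ℕ → X} {K : ℝ}
    (hK : ∀ (a : ℕ → ℂ) (A B : Finset ℕ), IsGreedySet a A B →
      ‖∑ k ∈ B, a k • b k‖ ≤ K * ‖∑ k ∈ A, a k • b k‖)
    {ε : ℕ → ℂ} (hε : ∀ k, ‖ε k‖ = 1) {A B : Finset ℕ} (hBA : B ⊆ A) :
    ‖∑ k ∈ B, ε k • b k‖ ≤ K * ‖∑ k ∈ A, ε k • b k‖ := by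
  classical
  -- Enlarging the coefficients on `B` by a factor `1 + t` makes `B` a greedy set; then `t → 0`.
  have hpert : ∀ t : ℝ, 0 < t →
      ‖((1 + t : ℝ) : ℂ) • ∑ k ∈ B, ε k • b k‖ ≤
        K * ‖∑ k ∈ A, ε k • b k + (t : ℂ) • ∑ k ∈ B, ε k • b k‖ := by
    intro t ht
    have hn : ‖((1 + t : ℝ) : ℂ)‖ = 1 + t := by
      rw [Complex.norm_real, Real.norm_of_nonneg (by linarith)]
    have hpos : ((1 + t : ℝ) : ℂ) ≠ 0 := by
      rw [← norm_pos_iff, hn]; linarith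
    have hε0 : ∀ k, ε k ≠ 0 := fun k => norm_pos_iff.1 (by rw [hε]; exact one_pos)
    have h1 := hK (fun k => if k ∈ B then ((1 + t : ℝ) : ℂ) * ε k else ε k) A B
      ⟨hBA, fun k _ => by
        by_cases hk : k ∈ B
        · simpa only [if_pos hk] using mul_ne_zero hpos (hε0 k)
        · simpa only [if_neg hk] using hε0 k,
      fun k hk j _ hj => by
        simp only [if_pos hk, if_neg hj]
        rw [norm_mul, hε, hε, hn]; linarith⟩
    have hB : ∑ k ∈ B, (if k ∈ B then ((1 + t : ℝ) : ℂ) * ε k else ε k) • b k =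
        ((1 + t : ℝ) : ℂ) • ∑ k ∈ B, ε k • b k := by
      rw [Finset.smul_sum]
      exact Finset.sum_congr rfl fun k hk => by rw [if_pos hk, mul_smul]
    have hA : ∑ k ∈ A, (if k ∈ B then ((1 + t : ℝ) : ℂ) * ε k else ε k) • b k =
        ∑ k ∈ A, ε k • b k + (t : ℂ) • ∑ k ∈ B, ε k • b k := by
      rw [← Finset.sum_sdiff hBA, hB, ← Finset.sum_sdiff hBA (f := fun k => ε k • b k)]
      rw [Finset.sum_congr rfl fun k hk => by rw [if_neg (Finset.mem_sdiff.1 hk).2]]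
      push_cast
      rw [add_smul, one_smul]
      abel
    rwa [hB, hA] at h1
  have hl : Tendsto (fun t : ℝ => ‖((1 + t : ℝ) : ℂ) • ∑ k ∈ B, ε k • b k‖) (𝓝[>] 0)
      (𝓝 ‖∑ k ∈ B, ε k • b k‖) := by
    have : Continuous fun t : ℝ => ‖((1 + t : ℝ) : ℂ) • ∑ k ∈ B, ε k • b k‖ := by fun_prop
    have h2 := (this.tendsto 0).mono_left (nhdsWithin_le_nhds (s := Set.Ioi 0))
    simpa using h2
  have hr : Tendsto (fun t : ℝ => K * ‖∑ k ∈ A, ε k • b k + (t : ℂ) • ∑ k ∈ B, ε k • b k‖)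
      (𝓝[>] 0) (𝓝 (K * ‖∑ k ∈ A, ε k • b k‖)) := by
    have : Continuous fun t : ℝ =>
        K * ‖∑ k ∈ A, ε k • b k + (t : ℂ) • ∑ k ∈ B, ε k • b k‖ := by fun_prop
    have h2 := (this.tendsto 0).mono_left (nhdsWithin_le_nhds (s := Set.Ioi 0))
    simpa using h2
  exact le_of_tendsto_of_tendsto hl hr
    (eventually_nhdsWithin_of_forall fun t ht => hpert t ht)

end GreedyProjections

/-! ### Unimodular sums in Hilbert spaces -/

section Signs

variable {H : Type*} [NormedAddCommGroup H] [InnerProductSpace ℂ H]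

/-- By the parallelogram law, the smaller of `‖x ± y‖²` is at most `‖x‖² + ‖y‖²`; signs are chosen
one at a time. -/
theorem exists_signs_norm_sum_sq_le (x : ℕ → H) (A : Finset ℕ) :
    ∃ σ : ℕ → ℂ, (∀ k, σ k = 1 ∨ σ k = -1) ∧
      ‖∑ k ∈ A, σ k • x k‖ ^ 2 ≤ ∑ k ∈ A, ‖x k‖ ^ 2 := by
  classical
  induction A using Finset.induction_on with
  | empty => exact ⟨fun _ => 1, fun _ => Or.inl rfl, by simp⟩
  | insert i A hi ih =>
    obtain ⟨σ, hσ, h⟩ := ih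
    have hpar := parallelogram_law_with_norm ℂ (x i) (∑ k ∈ A, σ k • x k)
    have hrest : ∀ z : ℂ, ∑ k ∈ A, Function.update σ i z k • x k = ∑ k ∈ A, σ k • x k := fun z =>
      Finset.sum_congr rfl fun k hk => by
        rw [Function.update_of_ne (ne_of_mem_of_not_mem hk hi)]
    have hupd : ∀ z : ℂ, (z = 1 ∨ z = -1) →
        ∀ k, Function.update σ i z k = 1 ∨ Function.update σ i z k = -1 := by
      intro z hz k
      by_cases hk : k = i
      · subst hk; simpa using hz
      · rw [Function.update_of_ne hk]; exact hσ k
    rcases le_total ‖x i + ∑ k ∈ A, σ k • x k‖ ‖x i - ∑ k ∈ A, σ k • x k‖ with hle | hle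
    · refine ⟨Function.update σ i 1, hupd 1 (Or.inl rfl), ?_⟩
      rw [Finset.sum_insert hi, Finset.sum_insert hi, hrest, Function.update_self, one_smul]
      nlinarith [norm_nonneg (x i + ∑ k ∈ A, σ k • x k)]
    · refine ⟨Function.update σ i (-1), hupd (-1) (Or.inr rfl), ?_⟩
      rw [Finset.sum_insert hi, Finset.sum_insert hi, hrest, Function.update_self, neg_one_smul,
        neg_add_eq_sub, norm_sub_rev]
      nlinarith [norm_nonneg (x i - ∑ k ∈ A, σ k • x k)]

/-- By the parallelogram law, the larger of `‖x ± y‖²` is at least `‖x‖² + ‖y‖²`; signs are chosen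
one at a time. -/
theorem exists_signs_le_norm_sum_sq (x : ℕ → H) (A : Finset ℕ) :
    ∃ σ : ℕ → ℂ, (∀ k, σ k = 1 ∨ σ k = -1) ∧
      ∑ k ∈ A, ‖x k‖ ^ 2 ≤ ‖∑ k ∈ A, σ k • x k‖ ^ 2 := by
  classical
  induction A using Finset.induction_on with
  | empty => exact ⟨fun _ => 1, fun _ => Or.inl rfl, by simp⟩
  | insert i A hi ih =>
    obtain ⟨σ, hσ, h⟩ := ih
    have hpar := parallelogram_law_with_norm ℂ (x i) (∑ k ∈ A, σ k • x k)
    have hrest : ∀ z : ℂ, ∑ k ∈ A, Function.update σ i z k • x k = ∑ k ∈ A, σ k • x k := fun z =>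
      Finset.sum_congr rfl fun k hk => by
        rw [Function.update_of_ne (ne_of_mem_of_not_mem hk hi)]
    have hupd : ∀ z : ℂ, (z = 1 ∨ z = -1) →
        ∀ k, Function.update σ i z k = 1 ∨ Function.update σ i z k = -1 := by
      intro z hz k
      by_cases hk : k = i
      · subst hk; simpa using hz
      · rw [Function.update_of_ne hk]; exact hσ k
    rcases le_total ‖x i - ∑ k ∈ A, σ k • x k‖ ‖x i + ∑ k ∈ A, σ k • x k‖ with hle | hle
    · refine ⟨Function.update σ i 1, hupd 1 (Or.inl rfl), ?_⟩
      rw [Finset.sum_insert hi, Finset.sum_insert hi, hrest, Function.update_self, one_smul]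
      nlinarith [norm_nonneg (x i - ∑ k ∈ A, σ k • x k)]
    · refine ⟨Function.update σ i (-1), hupd (-1) (Or.inr rfl), ?_⟩
      rw [Finset.sum_insert hi, Finset.sum_insert hi, hrest, Function.update_self, neg_one_smul,
        neg_add_eq_sub, norm_sub_rev]
      nlinarith [norm_nonneg (x i + ∑ k ∈ A, σ k • x k)]

theorem norm_sum_le_of_signs {b : ℕ → H} {K : ℝ}
    (hK : ∀ ε : ℕ → ℂ, (∀ k, ‖ε k‖ = 1) → ∀ A B : Finset ℕ, B ⊆ A →
      ‖∑ k ∈ B, ε k • b k‖ ≤ K * ‖∑ k ∈ A, ε k • b k‖)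
    {ε σ : ℕ → ℂ} (hε : ∀ k, ‖ε k‖ = 1) (hσ : ∀ k, σ k = 1 ∨ σ k = -1) (A : Finset ℕ) :
    ‖∑ k ∈ A, σ k • ε k • b k‖ ≤ 2 * K * ‖∑ k ∈ A, ε k • b k‖ := by
  classical
  have h1 : ∑ k ∈ A, σ k • ε k • b k =
      ∑ k ∈ A with σ k = 1, ε k • b k - ∑ k ∈ A with ¬ σ k = 1, ε k • b k := by
    rw [← Finset.sum_filter_add_sum_filter_not A (fun k => σ k = 1), sub_eq_add_neg,
      ← Finset.sum_neg_distrib]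
    congr 1
    · exact Finset.sum_congr rfl fun k hk => by rw [(Finset.mem_filter.1 hk).2, one_smul]
    · refine Finset.sum_congr rfl fun k hk => ?_
      rw [(hσ k).resolve_left (Finset.mem_filter.1 hk).2, neg_one_smul]
  rw [h1]
  have h2 := hK ε hε A _ (Finset.filter_subset (fun k => σ k = 1) A)
  have h3 := hK ε hε A _ (Finset.filter_subset (fun k => ¬ σ k = 1) A)
  linarith [norm_sub_le (∑ k ∈ A with σ k = 1, ε k • b k) (∑ k ∈ A with ¬ σ k = 1, ε k • b k)]

/-- In a Hilbert space, unconditionality for constant coefficients forces unimodular sums to have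
the size of orthogonal ones, because the average over signs of the squared norm is exactly the
orthogonal value. -/
theorem norm_sum_unimodular_sq_bounds {b : ℕ → H} {K : ℝ}
    (hK : ∀ ε : ℕ → ℂ, (∀ k, ‖ε k‖ = 1) → ∀ A B : Finset ℕ, B ⊆ A →
      ‖∑ k ∈ B, ε k • b k‖ ≤ K * ‖∑ k ∈ A, ε k • b k‖)
    {ε : ℕ → ℂ} (hε : ∀ k, ‖ε k‖ = 1) (A : Finset ℕ) :
    ‖∑ k ∈ A, ε k • b k‖ ^ 2 ≤ (2 * K) ^ 2 * ∑ k ∈ A, ‖b k‖ ^ 2 ∧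
      ∑ k ∈ A, ‖b k‖ ^ 2 ≤ (2 * K) ^ 2 * ‖∑ k ∈ A, ε k • b k‖ ^ 2 := by
  have hnorm : ∀ k, ‖ε k • b k‖ = ‖b k‖ := fun k => by rw [norm_smul, hε, one_mul]
  constructor
  · obtain ⟨σ, hσ, h⟩ := exists_signs_norm_sum_sq_le (fun k => ε k • b k) A
    simp only [hnorm] at h
    -- The sum with coefficients `ε` arises from the one with `σ * ε` by changing signs along `σ`.
    have hσε : ∀ k, ‖σ k * ε k‖ = 1 := fun k => by
      rcases hσ k with h | h <;> simp [h, hε]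
    have h1 := norm_sum_le_of_signs hK hσε hσ A
    have h2 : ∑ k ∈ A, σ k • (σ k * ε k) • b k = ∑ k ∈ A, ε k • b k :=
      Finset.sum_congr rfl fun k _ => by rcases hσ k with h | h <;> simp [h]
    rw [h2] at h1
    simp only [mul_smul] at h1
    calc ‖∑ k ∈ A, ε k • b k‖ ^ 2 ≤ (2 * K * ‖∑ k ∈ A, σ k • ε k • b k‖) ^ 2 :=
          pow_le_pow_left₀ (norm_nonneg _) h1 2
      _ = (2 * K) ^ 2 * ‖∑ k ∈ A, σ k • ε k • b k‖ ^ 2 := by ring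
      _ ≤ _ := mul_le_mul_of_nonneg_left h (sq_nonneg _)
  · obtain ⟨σ, hσ, h⟩ := exists_signs_le_norm_sum_sq (fun k => ε k • b k) A
    simp only [hnorm] at h
    refine h.trans ?_
    have h1 := norm_sum_le_of_signs hK hε hσ A
    calc ‖∑ k ∈ A, σ k • ε k • b k‖ ^ 2 ≤ (2 * K * ‖∑ k ∈ A, ε k • b k‖) ^ 2 :=
          pow_le_pow_left₀ (norm_nonneg _) h1 2
      _ = _ := by ring

end Signs

/-! ### Fourier averages of stationary sequences -/

section Toeplitz

open AddCircle
open scoped ComplexConjugate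

theorem integral_fourier_eq_ite (m : ℤ) :
    ∫ θ : UnitAddCircle, fourier m θ ∂haarAddCircle = if m = 0 then 1 else 0 := by
  split_ifs with h
  · simp [h]
  · exact integral_eq_zero_of_add_right_eq_neg (fourier_add_half_inv_index h one_pos)

variable {H : Type*} [NormedAddCommGroup H] [InnerProductSpace ℂ H]

theorem integral_norm_sq_sum_fourier {ι : Type*} (s : Finset ι) (n : ι → ℤ) (v : ι → H) :
    ((∫ θ : UnitAddCircle, ‖∑ i ∈ s, fourier (n i) θ • v i‖ ^ 2 ∂haarAddCircle : ℝ) : ℂ) =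
      ∑ i ∈ s, ∑ j ∈ s, if n i = n j then inner ℂ (v i) (v j) else 0 := by
  have hpt : ∀ θ : UnitAddCircle, ((‖∑ i ∈ s, fourier (n i) θ • v i‖ ^ 2 : ℝ) : ℂ) =
      ∑ i ∈ s, ∑ j ∈ s, fourier (n j - n i) θ * inner ℂ (v i) (v j) := by
    intro θ
    have h1 := inner_self_eq_norm_sq_to_K (𝕜 := ℂ) (∑ i ∈ s, fourier (n i) θ • v i)
    rw [Complex.ofReal_pow]
    refine h1.symm.trans ?_
    rw [sum_inner]
    refine Finset.sum_congr rfl fun i _ => ?_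
    rw [inner_sum]
    refine Finset.sum_congr rfl fun j _ => ?_
    rw [inner_smul_left, inner_smul_right, sub_eq_add_neg, fourier_add, fourier_neg]
    ring
  rw [← integral_complex_ofReal]
  simp_rw [hpt]
  have hint : ∀ i j, Integrable
      (fun θ : UnitAddCircle => fourier (n j - n i) θ * inner ℂ (v i) (v j)) haarAddCircle :=
    fun i j => (Continuous.integrable_of_hasCompactSupport (by fun_prop)
      (HasCompactSupport.of_compactSpace _))
  rw [integral_finsetSum _ fun i _ => integrable_finsetSum _ fun j _ => hint i j]
  refine Finset.sum_congr rfl fun i _ => ?_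
  rw [integral_finsetSum _ fun j _ => hint i j]
  refine Finset.sum_congr rfl fun j _ => ?_
  rw [integral_mul_const, integral_fourier_eq_ite]
  by_cases h : n i = n j
  · simp [h]
  · rw [if_neg h, if_neg fun h' => h (sub_eq_zero.1 h').symm, zero_mul]

/-- The number of pairs in `{0, …, N - 1}²` on the `m`-th diagonal. -/
def diagonalCount (m : ℤ) (N : ℕ) : ℕ :=
  ((Finset.range N ×ˢ Finset.range N).filter fun p => (p.2 : ℤ) - p.1 = m).card

theorem diagonalCount_le (m : ℤ) (N : ℕ) : diagonalCount m N ≤ N := by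
  classical
  have h : diagonalCount m N ≤ (Finset.range N).card := by
    refine Finset.card_le_card_of_injOn Prod.fst (fun p hp => ?_) fun p hp q hq hpq => ?_
    · simp only [Finset.coe_filter, Finset.mem_product, Set.mem_ofPred_eq] at hp
      exact hp.1.1
    · simp only [Finset.coe_filter, Finset.mem_product, Set.mem_ofPred_eq] at hp hq
      refine Prod.ext hpq ?_
      have : (p.2 : ℤ) = q.2 := by
        have := hp.2.trans hq.2.symm
        rw [hpq] at this
        linarith
      exact_mod_cast this
  simpa using h

theorem sub_natAbs_le_diagonalCount (m : ℤ) (N : ℕ) : N - m.natAbs ≤ diagonalCount m N := by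
  classical
  have h : (Finset.range (N - m.natAbs)).card ≤ diagonalCount m N := by
    refine Finset.card_le_card_of_injOn (fun k => (k + (-m).toNat, k + m.toNat))
      (fun k hk => ?_) fun k _ l _ hkl => ?_
    · simp only [Finset.coe_range, Set.mem_Iio] at hk
      simp only [Finset.coe_filter, Finset.mem_product, Finset.mem_range, Set.mem_ofPred_eq]
      refine ⟨⟨by omega, by omega⟩, ?_⟩
      push_cast
      omega
    · simpa using congrArg Prod.fst hkl
  simpa using h

theorem tendsto_diagonalCount_div (m : ℤ) :
    Tendsto (fun N : ℕ => (diagonalCount m N : ℝ) / N) atTop (𝓝 1) := by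
  have hlow : Tendsto (fun N : ℕ => 1 - (m.natAbs : ℝ) / N) atTop (𝓝 1) := by
    simpa using tendsto_const_nhds.sub (tendsto_const_div_atTop_nhds_zero_nat (m.natAbs : ℝ))
  refine tendsto_of_tendsto_of_tendsto_of_le_of_le' hlow tendsto_const_nhds ?_ ?_
  · filter_upwards [eventually_gt_atTop 0] with N hN
    have hN' : (0 : ℝ) < N := by exact_mod_cast hN
    rw [le_div_iff₀ hN', sub_mul, one_mul, div_mul_cancel₀ _ hN'.ne']
    have h1 := sub_natAbs_le_diagonalCount m N
    have h2 : N ≤ diagonalCount m N + m.natAbs := by omega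
    have h3 : (N : ℝ) ≤ diagonalCount m N + m.natAbs := by exact_mod_cast h2
    linarith
  · exact Eventually.of_forall fun N =>
      div_le_one_of_le₀ (by exact_mod_cast diagonalCount_le m N) (Nat.cast_nonneg _)

variable {ι : Type*}

/-- The mean over `θ` of `|∑ a_i e^{i n_i θ}|² ‖∑_{k < N} e^{-ikθ} e_k‖²`, when `b` and `e` are
stationary with the same correlation function. -/
theorem integral_norm_sq_mul_norm_sq {b : ι → H} {e : ℕ → H} {n : ι → ℤ} {g : ℤ → ℂ}
    (hb : ∀ i j, inner ℂ (b i) (b j) = g (n j - n i))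
    (he : ∀ j k : ℕ, inner ℂ (e j) (e k) = g ((k : ℤ) - j)) (s : Finset ι) (a : ι → ℂ) (N : ℕ) :
    ((∫ θ : UnitAddCircle, ‖∑ i ∈ s, fourier (n i) θ • a i‖ ^ 2 *
        ‖∑ k ∈ Finset.range N, fourier (-(k : ℤ)) θ • e k‖ ^ 2 ∂haarAddCircle : ℝ) : ℂ) =
      ∑ i ∈ s, ∑ j ∈ s, inner ℂ (a i • b i) (a j • b j) * (diagonalCount (n j - n i) N : ℂ) := by
  classical
  have hprod : ∀ θ : UnitAddCircle, ‖∑ i ∈ s, fourier (n i) θ • a i‖ ^ 2 *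
        ‖∑ k ∈ Finset.range N, fourier (-(k : ℤ)) θ • e k‖ ^ 2 =
      ‖∑ p ∈ s ×ˢ Finset.range N, fourier (n p.1 + -(p.2 : ℤ)) θ • a p.1 • e p.2‖ ^ 2 := by
    intro θ
    rw [← mul_pow, ← norm_smul, Finset.sum_smul, Finset.sum_product]
    congr 2
    refine Finset.sum_congr rfl fun i _ => ?_
    rw [Finset.smul_sum]
    refine Finset.sum_congr rfl fun k _ => ?_
    rw [fourier_add, smul_smul, smul_smul]
    congr 1
    simp only [smul_eq_mul]
    ring
  simp_rw [hprod]
  rw [integral_norm_sq_sum_fourier (s ×ˢ Finset.range N) (fun p => n p.1 + -(p.2 : ℤ))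
    (fun p => a p.1 • e p.2), Finset.sum_product]
  refine Finset.sum_congr rfl fun i _ => ?_
  simp only [Finset.sum_product]
  rw [Finset.sum_comm]
  refine Finset.sum_congr rfl fun j _ => ?_
  rw [← Finset.sum_product', diagonalCount, Finset.card_filter, Nat.cast_sum, Finset.mul_sum]
  refine Finset.sum_congr rfl fun p _ => ?_
  by_cases h : (p.2 : ℤ) - p.1 = n j - n i
  · rw [if_pos h, if_pos (by linarith), inner_smul_left, inner_smul_right, inner_smul_left,
      inner_smul_right, he, hb, h]
    simp
  · rw [if_neg h, if_neg fun h' => h (by linarith)]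
    simp

theorem tendsto_integral_norm_sq_div {b : ι → H} {e : ℕ → H} {n : ι → ℤ} {g : ℤ → ℂ}
    (hb : ∀ i j, inner ℂ (b i) (b j) = g (n j - n i))
    (he : ∀ j k : ℕ, inner ℂ (e j) (e k) = g ((k : ℤ) - j)) (s : Finset ι) (a : ι → ℂ) :
    Tendsto (fun N : ℕ => (∫ θ : UnitAddCircle, ‖∑ i ∈ s, fourier (n i) θ • a i‖ ^ 2 *
        ‖∑ k ∈ Finset.range N, fourier (-(k : ℤ)) θ • e k‖ ^ 2 ∂haarAddCircle) / N) atTop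
      (𝓝 (‖∑ i ∈ s, a i • b i‖ ^ 2)) := by
  have h1 : Tendsto (fun N : ℕ => ∑ i ∈ s, ∑ j ∈ s, inner ℂ (a i • b i) (a j • b j) *
      (((diagonalCount (n j - n i) N : ℝ) / N : ℝ) : ℂ)) atTop
      (𝓝 (∑ i ∈ s, ∑ j ∈ s, inner ℂ (a i • b i) (a j • b j) * ((1 : ℝ) : ℂ))) :=
    tendsto_finsetSum _ fun i _ => tendsto_finsetSum _ fun j _ =>
      ((Complex.continuous_ofReal.tendsto _).comp (tendsto_diagonalCount_div _)).const_mul _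
  have h2 : ∑ i ∈ s, ∑ j ∈ s, inner ℂ (a i • b i) (a j • b j) * ((1 : ℝ) : ℂ) =
      ((‖∑ i ∈ s, a i • b i‖ ^ 2 : ℝ) : ℂ) := by
    rw [Complex.ofReal_pow]
    refine Eq.trans ?_ (inner_self_eq_norm_sq_to_K (𝕜 := ℂ) (∑ i ∈ s, a i • b i))
    rw [sum_inner]
    simp only [inner_sum, Complex.ofReal_one, mul_one]
  rw [h2] at h1
  have h3 := (Complex.continuous_re.tendsto _).comp h1
  rw [Complex.ofReal_re] at h3
  refine h3.congr fun N => ?_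
  have h4 := integral_norm_sq_mul_norm_sq hb he s a N
  have h5 : ∑ i ∈ s, ∑ j ∈ s, inner ℂ (a i • b i) (a j • b j) *
      (((diagonalCount (n j - n i) N : ℝ) / N : ℝ) : ℂ) =
      (((∫ θ : UnitAddCircle, ‖∑ i ∈ s, fourier (n i) θ • a i‖ ^ 2 *
        ‖∑ k ∈ Finset.range N, fourier (-(k : ℤ)) θ • e k‖ ^ 2 ∂haarAddCircle) / N : ℝ) : ℂ) := by
    rw [Complex.ofReal_div, h4, Finset.sum_div]
    refine Finset.sum_congr rfl fun i _ => ?_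
    rw [Finset.sum_div]
    refine Finset.sum_congr rfl fun j _ => ?_
    push_cast
    ring
  rw [Function.comp_apply, h5, Complex.ofReal_re]

/-- A stationary sequence whose unimodular sums over `{0, …, N - 1}` have squared norm comparable
with `N` satisfies the Riesz inequalities with the same constants: averaging the hypothesis over `θ`
against the density `|∑ a_i e^{i n_i θ}|²` and dividing by `N` gives, as `N → ∞`,
the norm of `∑ a_i b_i`. -/
theorem riesz_bounds_of_stationary {b : ι → H} {e : ℕ → H} {n : ι → ℤ} {g : ℤ → ℂ}
    (hn : Function.Injective n) (hb : ∀ i j, inner ℂ (b i) (b j) = g (n j - n i))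
    (he : ∀ j k : ℕ, inner ℂ (e j) (e k) = g ((k : ℤ) - j)) {c C : ℝ}
    (hlow : ∀ (N : ℕ) (ε : ℕ → ℂ), (∀ k, ‖ε k‖ = 1) →
      c * N ≤ ‖∑ k ∈ Finset.range N, ε k • e k‖ ^ 2)
    (hup : ∀ (N : ℕ) (ε : ℕ → ℂ), (∀ k, ‖ε k‖ = 1) →
      ‖∑ k ∈ Finset.range N, ε k • e k‖ ^ 2 ≤ C * N) (s : Finset ι) (a : ι → ℂ) :
    c * ∑ i ∈ s, ‖a i‖ ^ 2 ≤ ‖∑ i ∈ s, a i • b i‖ ^ 2 ∧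
      ‖∑ i ∈ s, a i • b i‖ ^ 2 ≤ C * ∑ i ∈ s, ‖a i‖ ^ 2 := by
  classical
  have hlim := tendsto_integral_norm_sq_div hb he s a
  have hmass : ∫ θ : UnitAddCircle, ‖∑ i ∈ s, fourier (n i) θ • a i‖ ^ 2 ∂haarAddCircle =
      ∑ i ∈ s, ‖a i‖ ^ 2 := by
    have h1 := integral_norm_sq_sum_fourier s n a
    have h2 : ∀ i ∈ s, (∑ j ∈ s, if n i = n j then inner ℂ (a i) (a j) else 0) =
        ((‖a i‖ ^ 2 : ℝ) : ℂ) := by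
      intro i hi
      simp only [hn.eq_iff]
      rw [Finset.sum_ite_eq, if_pos hi, Complex.ofReal_pow]
      exact inner_self_eq_norm_sq_to_K (𝕜 := ℂ) (a i)
    rw [Finset.sum_congr rfl h2, ← Complex.ofReal_sum] at h1
    exact_mod_cast h1
  have hint : ∀ f : UnitAddCircle → ℝ, Continuous f → Integrable f haarAddCircle := fun f hf =>
    hf.integrable_of_hasCompactSupport (HasCompactSupport.of_compactSpace _)
  have hunit : ∀ (θ : UnitAddCircle) (k : ℕ), ‖(fourier (-(k : ℤ)) θ : ℂ)‖ = 1 := fun θ k => by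
    rw [fourier_apply, Circle.norm_coe]
  constructor
  · refine ge_of_tendsto hlim ?_
    filter_upwards [eventually_gt_atTop 0] with N hN
    have hN' : (0 : ℝ) < N := by exact_mod_cast hN
    rw [le_div_iff₀ hN', ← hmass, mul_right_comm, ← integral_const_mul]
    refine integral_mono (hint _ (by fun_prop)) (hint _ (by fun_prop)) fun θ => ?_
    simp only
    rw [mul_comm]
    exact mul_le_mul_of_nonneg_left (hlow N _ (hunit θ)) (sq_nonneg _)
  · refine le_of_tendsto hlim ?_
    filter_upwards [eventually_gt_atTop 0] with N hN
    have hN' : (0 : ℝ) < N := by exact_mod_cast hN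
    rw [div_le_iff₀ hN', ← hmass, mul_right_comm, ← integral_const_mul]
    refine integral_mono (hint _ (by fun_prop)) (hint _ (by fun_prop)) fun θ => ?_
    simp only
    rw [mul_comm (C * (N : ℝ))]
    exact mul_le_mul_of_nonneg_left (hup N _ (hunit θ)) (sq_nonneg _)

end Toeplitz

/-! ### Riesz bases and unconditional bases -/

section RieszBases

variable {X : Type*} [NormedAddCommGroup X] [NormedSpace ℂ X]

theorem SchauderBasis.topologicalClosure_span (S : SchauderBasis ℂ X) :
    (Submodule.span ℂ (Set.range S)).topologicalClosure = ⊤ := by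
  rw [eq_top_iff]
  intro x _
  refine mem_closure_of_tendsto (S.tendsto_proj x) (Eventually.of_forall fun n => ?_)
  rw [SchauderBasis.proj_apply]
  exact Submodule.sum_mem _ fun k _ =>
    Submodule.smul_mem _ _ (Submodule.subset_span (Set.mem_range_self k))

/-- A Schauder basis satisfying the Riesz inequalities is unconditional: the lower inequality makes
the coefficients square summable, and the upper one then makes the expansion summable. -/
theorem IsRieszBasis.isUnconditionalBasis [CompleteSpace X] {S : SchauderBasis ℂ X}
    (h : IsRieszBasis S) : IsUnconditionalBasis S := by
  obtain ⟨-, A, B, hA, hB, hAB⟩ := h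
  have hexp : ∀ x, HasSum (fun k => S.coord k x • S k) x := by
    intro x
    have hlim := S.tendsto_proj x
    obtain ⟨M, hM⟩ := isBounded_iff_forall_norm_le.mp
      (Metric.isBounded_range_of_tendsto _ hlim)
    have hsq : Summable fun k => ‖S.coord k x‖ ^ 2 := by
      refine summable_of_sum_range_le (c := M ^ 2 / A) (fun k => sq_nonneg _) fun n => ?_
      rw [le_div_iff₀ hA, mul_comm]
      refine ((hAB (Finset.range n) fun k => S.coord k x).1).trans ?_
      have h1 := hM _ (Set.mem_range_self n)
      rw [SchauderBasis.proj_apply] at h1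
      exact pow_le_pow_left₀ (norm_nonneg _) h1 2
    have hsum : Summable fun k => S.coord k x • S k := by
      rw [summable_iff_vanishing_norm]
      intro ε hε
      obtain ⟨s, hs⟩ := summable_iff_vanishing_norm.1 hsq (ε ^ 2 / B) (by positivity)
      refine ⟨s, fun t ht => ?_⟩
      have h1 := hs t ht
      rw [Real.norm_of_nonneg (Finset.sum_nonneg fun k _ => sq_nonneg _), lt_div_iff₀ hB,
        mul_comm] at h1
      exact lt_of_pow_lt_pow_left₀ 2 hε.le (((hAB t fun k => S.coord k x).2).trans_lt h1)
    have hx : ∑' k, S.coord k x • S k = x := by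
      refine tendsto_nhds_unique hsum.hasSum.tendsto_sum_nat ?_
      simpa only [SchauderBasis.proj_apply] using hlim
    simpa only [hx] using hsum.hasSum
  exact ⟨⟨S.basis, S.coord, S.ortho, hexp⟩, rfl⟩

end RieszBases

section StationaryBases

variable {H : Type*} [NormedAddCommGroup H] [InnerProductSpace ℂ H]

/-- A quasi-greedy basis of a Hilbert space whose Gram matrix is a Toeplitz matrix, after
enumeration of the basis by integers, is a Riesz basis. -/
theorem IsQuasiGreedyBasis.isRieszBasis_of_stationary [CompleteSpace H] {b : ℕ → H}
    (hq : IsQuasiGreedyBasis b) {n : ℕ → ℤ} (hn : Function.Injective n)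
    (hn2 : ∀ k : ℕ, n (2 * k) = k) {g : ℤ → ℂ}
    (hb : ∀ i j, inner ℂ (b i) (b j) = g (n j - n i)) :
    IsRieszBasis b := by
  classical
  obtain ⟨S, rfl, ⟨c, C, hc, hcC⟩, hG⟩ := hq
  refine ⟨SchauderBasis.topologicalClosure_span S, ?_⟩
  obtain ⟨K, hK⟩ := exists_norm_sum_greedySet_le S hc (fun k => (hcC k).1) (fun k => (hcC k).2) hG
  have hnorm : ∀ k, ‖S k‖ ^ 2 = ‖S 0‖ ^ 2 := by
    intro k
    have h1 := inner_self_eq_norm_sq_to_K (𝕜 := ℂ) (S k)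
    have h2 := inner_self_eq_norm_sq_to_K (𝕜 := ℂ) (S 0)
    rw [hb, sub_self] at h1 h2
    have h3 := h1.symm.trans h2
    exact_mod_cast h3
  set κ := ‖S 0‖ ^ 2 with hκ
  have hκ0 : 0 < κ := pow_pos (hc.trans_le (hcC 0).1) 2
  -- The summand `1` keeps `D` positive without knowing that `K ≠ 0`.
  set D := (2 * K) ^ 2 + 1 with hD
  have hD0 : 0 < D := by positivity
  -- The even-indexed basis vectors run through the frequencies `0, 1, 2, …`.
  have hbounds : ∀ (N : ℕ) (ε : ℕ → ℂ), (∀ k, ‖ε k‖ = 1) →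
      ‖∑ k ∈ Finset.range N, ε k • S (2 * k)‖ ^ 2 ≤ (2 * K) ^ 2 * (κ * N) ∧
        κ * N ≤ (2 * K) ^ 2 * ‖∑ k ∈ Finset.range N, ε k • S (2 * k)‖ ^ 2 := by
    intro N ε hε
    have hinj : Set.InjOn (fun k => 2 * k) (Finset.range N : Set ℕ) := fun a _ b _ h => by
      simpa using h
    have h1 := norm_sum_unimodular_sq_bounds (b := S) (K := K)
      (fun ε hε A B hBA => norm_sum_unimodular_subset_le hK hε hBA)
      (ε := fun k => ε (k / 2)) (fun k => hε _) ((Finset.range N).image fun k => 2 * k)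
    rw [Finset.sum_image hinj, Finset.sum_image hinj] at h1
    simp only [hnorm, Finset.sum_const, Finset.card_range, nsmul_eq_mul,
      Nat.mul_div_cancel_left _ two_pos] at h1
    rwa [mul_comm (N : ℝ)] at h1
  refine ⟨κ / D, D * κ, by positivity, by positivity, fun s a => ?_⟩
  refine riesz_bounds_of_stationary (e := fun k => S (2 * k)) hn hb
    (fun j k => by rw [hb, hn2, hn2]) (fun N ε hε => ?_) (fun N ε hε => ?_) s a
  · have h1 := (hbounds N ε hε).2
    rw [div_mul_eq_mul_div, div_le_iff₀ hD0]
    nlinarith [sq_nonneg ‖∑ k ∈ Finset.range N, ε k • S (2 * k)‖]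
  · have h1 := (hbounds N ε hε).1
    have h2 : 0 ≤ κ * (N : ℝ) := by positivity
    nlinarith

end StationaryBases

/-! ### The trigonometric system -/

section TrigSystem

theorem trigIndex_injective : Function.Injective trigIndex := by
  intro i j hij
  unfold trigIndex at hij
  split_ifs at hij with hi hj hj <;> simp only [Nat.even_iff] at hi hj <;> omega

theorem trigIndex_two_mul (k : ℕ) : trigIndex (2 * k) = k := by
  simp [trigIndex]

theorem inner_trigFun (i j : ℕ) (t : ℝ) :
    inner ℂ (trigFun i t) (trigFun j t) = ((2 * Real.pi)⁻¹ : ℝ) *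
      Complex.exp (Complex.I * ((trigIndex j - trigIndex i : ℤ) : ℂ) * (t : ℂ)) := by
  have hs : ((Real.sqrt (2 * Real.pi))⁻¹ : ℝ) * (Real.sqrt (2 * Real.pi))⁻¹ =
      (2 * Real.pi)⁻¹ := by
    rw [← mul_inv, Real.mul_self_sqrt (by positivity)]
  rw [RCLike.inner_apply', trigFun, trigFun, map_mul, Complex.conj_ofReal, ← Complex.exp_conj, ← hs]
  have hconj : (starRingEnd ℂ) (Complex.I * (trigIndex i : ℂ) * (t : ℂ)) =
      -(Complex.I * (trigIndex i : ℂ) * (t : ℂ)) := by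
    simp
  have hexp : Complex.exp (Complex.I * ((trigIndex j - trigIndex i : ℤ) : ℂ) * (t : ℂ)) =
      Complex.exp (-(Complex.I * (trigIndex i : ℂ) * (t : ℂ))) *
        Complex.exp (Complex.I * (trigIndex j : ℂ) * (t : ℂ)) := by
    rw [← Complex.exp_add]
    congr 1
    push_cast
    ring
  rw [hconj, hexp]
  push_cast
  ring

/-- The correlation function of the weight: up to normalization, its Fourier coefficient at the
frequency `-m`. -/
noncomputable def weightCorrelation (w : ℝ → ℝ) (m : ℤ) : ℂ :=
  ∫ t, ((2 * Real.pi)⁻¹ : ℝ) * Complex.exp (Complex.I * (m : ℂ) * (t : ℂ)) ∂weightMeasure w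

/-- The Gram matrix of the trigonometric system is a Toeplitz matrix in the frequencies. -/
theorem inner_trigSystem {w : ℝ → ℝ} (h : ∀ k, MemLp (trigFun k) 2 (weightMeasure w)) (i j : ℕ) :
    inner ℂ (trigSystem h i) (trigSystem h j) =
      weightCorrelation w (trigIndex j - trigIndex i) := by
  rw [L2.inner_def, weightCorrelation]
  refine integral_congr_ae ?_
  filter_upwards [(h i).coeFn_toLp, (h j).coeFn_toLp] with t hi hj
  rw [trigSystem, trigSystem, hi, hj, inner_trigFun]

end TrigSystem

theorem mainTheorem2 (w : ℝ → ℝ) (hw_meas : AEMeasurable w volume)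
    (hw_per : Function.Periodic w (2 * Real.pi)) (hw_pos : ∀ᵐ t, 0 < w t)
    (hw : TrigIsQuasiGreedy w) :
    TrigIsRiesz w ∧ TrigIsUnconditional w := by
  obtain ⟨h, hq⟩ := hw
  have hR := hq.isRieszBasis_of_stationary trigIndex_injective trigIndex_two_mul
    (inner_trigSystem h)
  obtain ⟨S, hS, -⟩ := hq
  refine ⟨⟨h, hR⟩, h, ?_⟩
  rw [← hS] at hR ⊢
  exact hR.isUnconditionalBasis
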